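/- Let $n\ge 2$ and let $\Sigma_n$ be the $(n+1)$-polygon with one orbifold point of order three, that is, a closed disk with $n+1$ marked points on its boundary, no punctures, and one orbifold point $\times$ in its interior. An arc of $\Sigma_n$ is a curve in $\Sigma_n$ joining marked points, which does not meet itself except that its end points may coincide, does not meet $\times$, meets the marked points only in its end points, is not homotopic to a boundary segment (relative to the marked points and $\times$), and, if it cuts out a monogon, then that monogon contains $\times$; in this last case it is called a pending arc. Arcs are considered up to isotopy relative to the marked points and $\times$, parametrization and orientation. Two arcs are compatible if they are isotopic or have isotopic representatives that do not intersect outside the marked points. A triangulation $\tau$ of $\Sigma_n$ is a maximal collection of pairwise compatible arcs. It contains exactly one pending arc. Its triangles are the regions into which the arcs of $\tau$ other than the pending arc cut $\Sigma_n$: ordinary triangles, bounded by three sides, and one orbifold triangle, a digon containing $\times$ and the pending arc; its three sides are the two sides of the digon and the pending arc. A triangle is internal if none of its sides is a boundary segment. Let $Q(\tau)$ be the quiver whose vertices are the arcs of $\tau$, with, for each triangle $\Delta$ of $\tau$, an arrow $j\to i$ for each pair of sides $i,j$ of $\Delta$ that are arcs of $\tau$ and such that $i$ succeeds $j$ in the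 clockwise orientation of $\Delta$, together with a loop $\varepsilon$ at the pending arc. Each internal triangle $\Delta$ defines a 3-cycle $c_\Delta b_\Delta a_\Delta$ of $Q(\tau)$, up to rotation; let $$S(\tau)=\sum_{\Delta\ \mathrm{internal}} c_\Delta b_\Delta a_\Delta+\varepsilon^3 .$$ Let $\mathbb{C}\langle\langle Q(\tau)\rangle\rangle=\prod_{m\ge 0}\mathbb{C}C_m$ be the completed path algebra, where $C_m$ is the set of paths of length $m$, let $\mathfrak{M}=\prod_{m\ge 1}\mathbb{C}C_m$, and for an arrow $a$ let $\partial_a$ be the cyclic derivative, $\partial_a(a_m\cdots a_1)=\sum_{k:\,a_k=a}a_{k-1}\cdots a_1a_m\cdots a_{k+1}$ on cycles. The algebra $\Lambda(\tau)$ is the Jacobian algebra of $(Q(\tau),S(\tau))$, that is, the quotient of $\mathbb{C}\langle\langle Q(\tau)\rangle\rangle$ by the closure, in the $\mathfrak{M}$-adic topology, of the two-sided ideal generated by all $\partial_a(S(\tau))$. Then, for every triangulation $\tau$ of $\Sigma_n$, the $\mathbb{C}$-algebra $\Lambda(\tau)$ is finite-dimensional. -/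

import Mathlib

noncomputable section

namespace OrbifoldPolygon

/-! ### Completed path algebras -/

section PathAlgebra

variable {V : Type*} [Quiver V]

/-- All factorizations `p = q r` of a path (first `q`, then `r`), one for each of the
`length p + 1` points at which `p` can be cut. -/
def splits {i : V} : ∀ {j : V}, Quiver.Path i j → List (Σ k : V, Quiver.Path i k × Quiver.Path k j)
  | _, .nil => [⟨i, .nil, .nil⟩]
  | j, .cons p e =>
      ⟨j, p.cons e, .nil⟩ :: (splits p).map fun s => ⟨s.1, s.2.1, s.2.2.cons e⟩

/-- The coefficient at `p` of a product: the sum of `f r * g q` over the factorizations of `p`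
into `q` followed by `r` (paths are composed like functions, from right to left). -/
def convolution {i j : V} (f : ∀ k, Quiver.Path k j → ℂ) (g : ∀ k, Quiver.Path i k → ℂ) (p : Quiver.Path i j) : ℂ :=
  ((splits p).map fun s => f s.1 s.2.2 * g s.1 s.2.1).sum

theorem convolution_nil {i : V} (f : ∀ k, Quiver.Path k i → ℂ) (g : ∀ k, Quiver.Path i k → ℂ) :
    convolution f g .nil = f i .nil * g i .nil := by
  simp [convolution, splits]

theorem convolution_cons {i j k : V} (f : ∀ l, Quiver.Path l k → ℂ) (g : ∀ l, Quiver.Path i l → ℂ)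
    (p : Quiver.Path i j) (e : j ⟶ k) :
    convolution f g (p.cons e) =
      f k .nil * g k (p.cons e) + convolution (fun l r => f l (r.cons e)) g p := by
  simp [convolution, splits, Function.comp_def]

theorem convolution_add_left {i j : V} (f f' : ∀ k, Quiver.Path k j → ℂ) (g : ∀ k, Quiver.Path i k → ℂ)
    (p : Quiver.Path i j) :
    convolution (fun k r => f k r + f' k r) g p = convolution f g p + convolution f' g p := by
  simp [convolution, add_mul, List.sum_map_add]

theorem convolution_add_right {i j : V} (f : ∀ k, Quiver.Path k j → ℂ) (g g' : ∀ k, Quiver.Path i k → ℂ)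
    (p : Quiver.Path i j) :
    convolution f (fun k q => g k q + g' k q) p = convolution f g p + convolution f g' p := by
  simp [convolution, mul_add, List.sum_map_add]

theorem convolution_smul_left {i j : V} (c : ℂ) (f : ∀ k, Quiver.Path k j → ℂ) (g : ∀ k, Quiver.Path i k → ℂ)
    (p : Quiver.Path i j) :
    convolution (fun k r => c * f k r) g p = c * convolution f g p := by
  simp [convolution, mul_assoc, List.sum_map_mul_left]

theorem convolution_smul_right {i j : V} (c : ℂ) (f : ∀ k, Quiver.Path k j → ℂ) (g : ∀ k, Quiver.Path i k → ℂ)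
    (p : Quiver.Path i j) :
    convolution f (fun k q => c * g k q) p = c * convolution f g p := by
  simp [convolution, mul_left_comm _ c, List.sum_map_mul_left]

theorem convolution_assoc {i j : V} (f : ∀ k, Quiver.Path k j → ℂ) (g : ∀ k l, Quiver.Path k l → ℂ)
    (h : ∀ k, Quiver.Path i k → ℂ) (p : Quiver.Path i j) :
    convolution (fun k r => convolution f (g k) r) h p =
      convolution f (fun k q => convolution (fun l => g l k) h q) p := by
  induction p with
  | nil => simp [convolution_nil, mul_assoc]
  | cons p e ih =>
    simp only [convolution_cons, convolution_nil, convolution_add_left, convolution_smul_left, ih]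
    ring

/-- The coefficients of the unit, that is of the sum of all paths of length zero. -/
def oneCoeff {i : V} : ∀ {j : V}, Quiver.Path i j → ℂ
  | _, .nil => 1
  | _, .cons _ _ => 0

theorem convolution_zero_left {i j : V} (g : ∀ k, Quiver.Path i k → ℂ) (p : Quiver.Path i j) :
    convolution (fun _ _ => 0) g p = 0 := by
  simp [convolution]

theorem convolution_zero_right {i j : V} (f : ∀ k, Quiver.Path k j → ℂ) (p : Quiver.Path i j) :
    convolution f (fun _ _ => 0) p = 0 := by
  simp [convolution]

theorem convolution_one_left {i j : V} (g : ∀ k, Quiver.Path i k → ℂ) (p : Quiver.Path i j) :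
    convolution (fun _ r => oneCoeff r) g p = g j p := by
  cases p with
  | nil => simp [convolution_nil, oneCoeff]
  | cons p e => simp [convolution_cons, oneCoeff, convolution_zero_left]

theorem convolution_one_right {i j : V} (f : ∀ k, Quiver.Path k j → ℂ) (p : Quiver.Path i j) :
    convolution f (fun _ q => oneCoeff q) p = f i p := by
  induction p with
  | nil => simp [convolution_nil, oneCoeff]
  | cons p e ih =>
    rw [convolution_cons, ih]
    simp [oneCoeff]

variable (V) in
/-- The completed path algebra `ℂ⟨⟨Q⟩⟩ = ∏ₘ ℂCₘ` of a (finite) quiver `Q` with vertex set `V`,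
where `Cₘ` is the set of paths of length `m`: an element is an arbitrary family of coefficients
indexed by the paths of `Q`. -/
def CompletedPathAlgebra : Type _ := ∀ i j : V, Quiver.Path i j → ℂ

namespace CompletedPathAlgebra

instance : AddCommGroup (CompletedPathAlgebra V) :=
  inferInstanceAs (AddCommGroup (∀ i j : V, Quiver.Path i j → ℂ))

instance : Module ℂ (CompletedPathAlgebra V) :=
  inferInstanceAs (Module ℂ (∀ i j : V, Quiver.Path i j → ℂ))

instance : Mul (CompletedPathAlgebra V) :=
  ⟨fun f g i j p => convolution (fun k => f k j) (g i) p⟩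

instance : One (CompletedPathAlgebra V) := ⟨fun _ _ p => oneCoeff p⟩

instance : Ring (CompletedPathAlgebra V) :=
  { (inferInstance : AddCommGroup (CompletedPathAlgebra V)),
    (inferInstance : Mul (CompletedPathAlgebra V)),
    (inferInstance : One (CompletedPathAlgebra V)) with
    left_distrib := fun f g h => funext fun i => funext fun j => funext fun p =>
      convolution_add_right (fun k => f k j) (g i) (h i) p
    right_distrib := fun f g h => funext fun i => funext fun j => funext fun p =>
      convolution_add_left (fun k => f k j) (fun k => g k j) (h i) p
    zero_mul := fun g => funext fun i => funext fun _ => funext fun p =>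
      convolution_zero_left (g i) p
    mul_zero := fun f => funext fun _ => funext fun j => funext fun p =>
      convolution_zero_right (fun k => f k j) p
    mul_assoc := fun f g h => funext fun i => funext fun j => funext fun p =>
      convolution_assoc (fun k => f k j) g (h i) p
    one_mul := fun g => funext fun i => funext fun _ => funext fun p =>
      convolution_one_left (g i) p
    mul_one := fun f => funext fun _ => funext fun j => funext fun p =>
      convolution_one_right (fun k => f k j) p }

instance : Algebra ℂ (CompletedPathAlgebra V) :=
  Algebra.ofModule
    (fun c f g => funext fun i => funext fun j => funext fun p =>
      convolution_smul_left c (fun k => f k j) (g i) p)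
    (fun c f g => funext fun i => funext fun j => funext fun p =>
      convolution_smul_right c (fun k => f k j) (g i) p)

end CompletedPathAlgebra

theorem convolution_eq_zero_left {l : ℕ} {i j : V} (f : ∀ k, Quiver.Path k j → ℂ)
    (g : ∀ k, Quiver.Path i k → ℂ) (hf : ∀ k (r : Quiver.Path k j), r.length < l → f k r = 0)
    (p : Quiver.Path i j) (hp : p.length < l) : convolution f g p = 0 := by
  induction p generalizing l with
  | nil => simp [convolution_nil, hf _ _ hp]
  | @cons b c p e ih =>
    have h0 : f c .nil = 0 := hf c .nil (by simpa using Nat.zero_lt_of_lt hp)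
    rw [convolution_cons, h0, zero_mul, zero_add]
    obtain ⟨m, rfl⟩ : ∃ m, l = m + 1 := ⟨l - 1, by have := Nat.zero_lt_of_lt hp; omega⟩
    exact ih (l := m) _ (fun k r hr => hf k (r.cons e) (by simpa using hr)) (by simpa using hp)

theorem convolution_eq_zero_right {l : ℕ} {i j : V} (f : ∀ k, Quiver.Path k j → ℂ)
    (g : ∀ k, Quiver.Path i k → ℂ) (hg : ∀ k (q : Quiver.Path i k), q.length < l → g k q = 0)
    (p : Quiver.Path i j) (hp : p.length < l) : convolution f g p = 0 := by
  induction p with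
  | nil => simp [convolution_nil, hg _ _ hp]
  | cons p e ih =>
    rw [convolution_cons, hg _ _ hp, mul_zero, zero_add]
    exact ih _ (by rw [Quiver.Path.length_cons] at hp; omega)

variable (V) in
/-- The power `𝔐ˡ = ∏_{m ≥ l} ℂCₘ` of the ideal `𝔐` generated by the arrows. -/
def arrowIdealPow (l : ℕ) : TwoSidedIdeal (CompletedPathAlgebra V) :=
  TwoSidedIdeal.mk' {f | ∀ (i j : V) (p : Quiver.Path i j), p.length < l → f i j p = 0}
    (fun _ _ _ _ => rfl)
    (fun {f g} hf hg i j p hp => by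
      change f i j p + g i j p = 0
      rw [hf i j p hp, hg i j p hp, add_zero])
    (fun {f} hf i j p hp => by
      change -f i j p = 0
      rw [hf i j p hp, neg_zero])
    (fun {f g} hg i j p hp =>
      convolution_eq_zero_right (fun k => f k j) (g i) (fun k q hq => hg i k q hq) p hp)
    (fun {f g} hf i j p hp =>
      convolution_eq_zero_left (fun k => f k j) (g i) (fun k r hr => hf k j r hr) p hp)

/-- The closure `⋂ₗ (I + 𝔐ˡ)` of a two-sided ideal in the `𝔐`-adic topology. -/
def adicClosure (I : TwoSidedIdeal (CompletedPathAlgebra V)) :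
    TwoSidedIdeal (CompletedPathAlgebra V) :=
  ⨅ l : ℕ, I ⊔ arrowIdealPow V l

/-! ### Jacobian algebras -/

variable (V) in
/-- A potential: a possibly infinite linear combination of cycles. -/
abbrev Potential : Type _ := ∀ i : V, Quiver.Path i i → ℂ

/-- The sum of a set of cycles, as a potential. -/
def sumOfCycles (C : Set (Σ i : V, Quiver.Path i i)) : Potential V :=
  fun i => Set.indicator {c | (⟨i, c⟩ : Σ i : V, Quiver.Path i i) ∈ C} 1

open Classical in
/-- The cyclic derivative with respect to an arrow `a : s ⟶ t`, extended linearly and continuously.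
A pair consisting of a cycle `c` and an occurrence of `a` in `c` contributes the path `p` obtained
by deleting that occurrence and reading `c` cyclically from there. Thus `p` runs from `t` to `s`,
and the pairs which contribute `p` correspond to the factorizations of `p` into `x` followed by `y`,
with `c` equal to `y`, then `a`, then `x`. -/
def cyclicDerivative {s t : V} (a : s ⟶ t) (S : Potential V) : CompletedPathAlgebra V :=
  fun i j p =>
    if h : i = t ∧ j = s then
      ((splits (p.cast h.1 h.2)).map fun x => S x.1 ((x.2.2.cons a).comp x.2.1)).sum
    else 0

/-- The Jacobian ideal: the closure of the two-sided ideal generated by the cyclic derivatives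
of the potential with respect to all arrows. -/
def jacobianIdeal (S : Potential V) : TwoSidedIdeal (CompletedPathAlgebra V) :=
  adicClosure (TwoSidedIdeal.span
    {f | ∃ (s t : V) (a : s ⟶ t), f = cyclicDerivative a S})

/-- The Jacobian algebra of a quiver with potential. -/
abbrev JacobianAlgebra (S : Potential V) : Type _ := (jacobianIdeal S).ringCon.Quotient

end PathAlgebra

/-! ### The polygon with one orbifold point

The surface `Σₙ` is the closed unit disk with the `n + 1` marked points
`v_a = exp (2πi a / (n + 1))`, `a ∈ ℤ/(n+1)`, which are in counterclockwise order, and the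
orbifold point `0`. The map `z ↦ exp (2πi z / (n + 1))` is the universal covering of the disk
without the orbifold point by the closed upper half plane; the marked points lift to the integers.
-/

/-- Curves in `Σₙ` joining marked points, up to isotopy relative to the marked points and the
orbifold point: the curve with `start = a` and `len = d` goes from `v_a` to `v_{a+d}`, has the
orbifold point on its left, and has on its right the boundary path from `v_a` counterclockwise
through `d` boundary segments to `v_{a+d}`. For `len = 1` it is a boundary segment, for
`2 ≤ len ≤ n` an arc with distinct end points, and for `len = n + 1` the loop at `v_a` around the
orbifold point. Between two distinct vertices `v_a`, `v_b` there are thus two curves, one on each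
side of the orbifold point. -/
@[ext]
structure Segment (n : ℕ) where
  start : ZMod (n + 1)
  len : ℕ
  one_le_len : 1 ≤ len
  len_le : len ≤ n + 1

namespace Segment

variable {n : ℕ}

/-- The segments of the boundary circle between consecutive marked points. -/
def IsBoundary (s : Segment n) : Prop := s.len = 1

/-- The arcs: neither boundary segments nor contractible. -/
def IsArc (s : Segment n) : Prop := 2 ≤ s.len

/-- The pending arcs: loops that cut out a monogon containing the orbifold point. -/
def IsPending (s : Segment n) : Prop := s.len = n + 1

/-- The geodesic representative of the isotopy class, without its end points: the image in the
disk of the half circle in the upper half plane over the interval `[a, a + d]`. -/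
def curve (s : Segment n) : Set ℂ :=
  (fun z : ℂ => Complex.exp (2 * Real.pi * Complex.I * z / (n + 1))) ''
    {z : ℂ | 0 < z.im ∧ ‖z - ((s.start.val : ℂ) + (s.len : ℂ) / 2)‖ = (s.len : ℝ) / 2}

/-- Two arcs are compatible if they are equal or do not intersect outside the marked points.
As geodesics are in minimal position, isotopic representatives need not be considered. -/
def Compatible (s t : Segment n) : Prop := s = t ∨ Disjoint s.curve t.curve

end Segment

/-- Three vertices `v_a`, `v_{a+d}`, `v_{a+d+e}`, in counterclockwise order. In the case
`d + e = n + 1`, where `v_{a+d+e} = v_a`, they are the vertices of the orbifold triangle formed by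
the digon with vertices `v_a` and `v_{a+d}` and, inside it, the pending arc at `v_a`. -/
@[ext]
structure Triple (n : ℕ) where
  start : ZMod (n + 1)
  d : ℕ
  e : ℕ
  one_le_d : 1 ≤ d
  one_le_e : 1 ≤ e
  add_le : d + e ≤ n + 1

/-- The three sides `[v_a, v_{a+d+e}]`, `[v_{a+d}, v_{a+d+e}]`, `[v_a, v_{a+d}]`,
in clockwise order. -/
def Triple.side {n : ℕ} (Δ : Triple n) : Fin 3 → Segment n :=
  ![⟨Δ.start, Δ.d + Δ.e, by have := Δ.one_le_d; omega, Δ.add_le⟩,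
    ⟨Δ.start + Δ.d, Δ.e, Δ.one_le_e, by have := Δ.add_le; omega⟩,
    ⟨Δ.start, Δ.d, Δ.one_le_d, by have := Δ.add_le; omega⟩]

/-- A triangulation of `Σₙ`: a maximal collection of pairwise compatible arcs. -/
structure Triangulation (n : ℕ) where
  arcs : Set (Segment n)
  isArc : ∀ s ∈ arcs, s.IsArc
  compatible : ∀ s ∈ arcs, ∀ t ∈ arcs, s.Compatible t
  maximal : ∀ s : Segment n, s.IsArc → (∀ t ∈ arcs, s.Compatible t) → s ∈ arcs

namespace Triangulation

variable {n : ℕ}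

/-- A triangle of `τ`: a triple of vertices all of whose sides are boundary segments or arcs
of `τ`. -/
structure Triangle (τ : Triangulation n) extends Triple n where
  side_mem : ∀ k, (toTriple.side k).IsBoundary ∨ toTriple.side k ∈ τ.arcs

/-- A triangle is internal if none of its sides is a boundary segment. -/
def Triangle.IsInternal {τ : Triangulation n} (Δ : τ.Triangle) : Prop :=
  ∀ k, Δ.side k ∈ τ.arcs

/-- The vertices of the quiver `Q(τ)`: the arcs of `τ`. -/
@[ext]
structure Vertex (τ : Triangulation n) where
  arc : Segment n
  mem : arc ∈ τ.arcs

/-- The arrows of the quiver `Q(τ)`: in each triangle an arrow from each side to the side which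
succeeds it in the clockwise orientation, if neither of the two is a boundary segment; and a loop
at the pending arc. -/
inductive Arrow (τ : Triangulation n) : τ.Vertex → τ.Vertex → Type
  | ofTriangle (Δ : τ.Triangle) (k : Fin 3) (h : Δ.side k ∈ τ.arcs)
      (h' : Δ.side (k + 1) ∈ τ.arcs) : Arrow τ ⟨Δ.side k, h⟩ ⟨Δ.side (k + 1), h'⟩
  | loop (i : τ.Vertex) (h : i.arc.IsPending) : Arrow τ i i

/-- The quiver `Q(τ)`. -/
instance (τ : Triangulation n) : Quiver τ.Vertex := ⟨τ.Arrow⟩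

/-- The arrow from the `k`-th to the `(k+1)`-st side of an internal triangle. -/
def triangleArrow (τ : Triangulation n) (Δ : τ.Triangle) (h : Δ.IsInternal) (k : Fin 3) :
    (⟨Δ.side k, h k⟩ : τ.Vertex) ⟶ ⟨Δ.side (k + 1), h (k + 1)⟩ :=
  Arrow.ofTriangle Δ k (h k) (h (k + 1))

/-- The 3-cycle defined by an internal triangle. -/
def triangleCycle (τ : Triangulation n) (Δ : τ.Triangle) (h : Δ.IsInternal) :
    Σ i : τ.Vertex, Quiver.Path i i :=
  ⟨⟨Δ.side 0, h 0⟩,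
    ((τ.triangleArrow Δ h 0).toPath.cons (τ.triangleArrow Δ h 1)).cons (τ.triangleArrow Δ h 2)⟩

/-- The loop `ε` at the pending arc `i`. -/
def loopArrow (τ : Triangulation n) (i : τ.Vertex) (h : i.arc.IsPending) : i ⟶ i :=
  Arrow.loop i h

/-- The cycle `ε³`. -/
def loopCycle (τ : Triangulation n) (i : τ.Vertex) (h : i.arc.IsPending) :
    Σ i : τ.Vertex, Quiver.Path i i :=
  ⟨i, ((τ.loopArrow i h).toPath.cons (τ.loopArrow i h)).cons (τ.loopArrow i h)⟩

/-- The potential `S(τ)`: the sum of the 3-cycles of the internal triangles and of `ε³`. -/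
def potential (τ : Triangulation n) : Potential τ.Vertex :=
  sumOfCycles ({c | ∃ (Δ : τ.Triangle) (h : Δ.IsInternal), c = τ.triangleCycle Δ h} ∪
    {c | ∃ (i : τ.Vertex) (h : i.arc.IsPending), c = τ.loopCycle i h})

/-- The algebra `Λ(τ)`: the Jacobian algebra of `(Q(τ), S(τ))`. -/
abbrev Lam (τ : Triangulation n) : Type := JacobianAlgebra τ.potential

end Triangulation

end OrbifoldPolygon

end

/-!
Let `b` follow `a` in a path of `Q(τ)`. Either `a` and `b` belong to the same triangle, or both are
the loop `ε`, and then up to a nonzero scalar their product is a cyclic derivative of `S(τ)`, so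
that it vanishes in `Λ(τ)`; or a rank of arrows strictly increases from `a` to `b`. Indeed a path
without such vanishing products climbs through longer and longer arcs, turns at most once, by
crossing a triangle under its longest arc or by `ε` at the pending arc, and then descends through
shorter and shorter arcs. Here one needs that arcs of `τ` do not cross: a triangle is then
determined by any one of its sides. The rank being bounded, all long paths lie in the Jacobian
ideal, which therefore contains a power of `𝔐`, and `Λ(τ)` is spanned by the finitely many shorter
paths.
-/

namespace OrbifoldPolygon

/-! ### Ideals containing a power of `𝔐` -/

section PathAlgebra

variable {V : Type*} [Quiver V]

namespace CompletedPathAlgebra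

theorem mul_apply (f g : CompletedPathAlgebra V) {i j : V} (p : Quiver.Path i j) :
    (f * g) i j p = convolution (fun k => f k j) (g i) p := rfl

theorem sum_apply {ι : Type*} (s : Finset ι) (f : ι → CompletedPathAlgebra V) {i j : V}
    (p : Quiver.Path i j) : (∑ x ∈ s, f x) i j p = ∑ x ∈ s, f x i j p :=
  map_sum (⟨⟨fun g => g i j p, rfl⟩, fun _ _ => rfl⟩ : CompletedPathAlgebra V →+ ℂ) f s

theorem mem_arrowIdealPow {l : ℕ} {f : CompletedPathAlgebra V} :
    f ∈ arrowIdealPow V l ↔ ∀ (i j : V) (p : Quiver.Path i j), p.length < l → f i j p = 0 :=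
  TwoSidedIdeal.mem_mk' _ _ _ _ _ _ _

open Classical in
/-- A path as an element of the completed path algebra. Paths are compared together with their end
points, so that the coefficient at a path between other vertices is defined, and equal to `0`. -/
noncomputable def ofPath {i j : V} (p : Quiver.Path i j) : CompletedPathAlgebra V :=
  fun s t q => if (⟨s, t, q⟩ : Σ s t : V, Quiver.Path s t) = ⟨i, j, p⟩ then 1 else 0

theorem eq_smul_ofPath {i j : V} (p : Quiver.Path i j) (f : CompletedPathAlgebra V)
    (hf : ∀ s t (q : Quiver.Path s t), f s t q ≠ 0 →
      (⟨s, t, q⟩ : Σ s t : V, Quiver.Path s t) = ⟨i, j, p⟩) :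
    f = f i j p • ofPath p := by
  funext s t q
  change f s t q = f i j p * ofPath p s t q
  by_cases hq : (⟨s, t, q⟩ : Σ s t : V, Quiver.Path s t) = ⟨i, j, p⟩
  · cases hq
    simp [ofPath]
  · simpa [ofPath, hq] using not_imp_not.2 (hf s t q) hq

theorem ofPath_toPath_mul_nil {k l : V} (e : k ⟶ l) (f : CompletedPathAlgebra V) (i : V) :
    (ofPath e.toPath * f) i i .nil = 0 := by
  have h : ofPath e.toPath i i .nil = 0 := if_neg (by rintro ⟨⟩)
  rw [mul_apply, convolution_nil, h, zero_mul]

open Classical in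
theorem ofPath_toPath_mul_cons {k l : V} (e : k ⟶ l) (f : CompletedPathAlgebra V) {i s t : V}
    (q : Quiver.Path i s) (a : s ⟶ t) :
    (ofPath e.toPath * f) i t (q.cons a) =
      if (⟨s, t, a⟩ : Σ s t : V, s ⟶ t) = ⟨k, l, e⟩ then f i s q else 0 := by
  have coeff_nil : ofPath e.toPath t t .nil = 0 := if_neg (by rintro ⟨⟩)
  have coeff_cons (v : V) (r : Quiver.Path v s) : ofPath e.toPath v t (r.cons a) =
      (if (⟨s, t, a⟩ : Σ s t : V, s ⟶ t) = ⟨k, l, e⟩ then 1 else 0) * oneCoeff r := by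
    rw [ofPath]
    cases r with
    | nil =>
      rw [oneCoeff, mul_one]
      exact if_congr ⟨fun h => by cases h; rfl, fun h => by cases h; rfl⟩ rfl rfl
    | cons r b =>
      rw [oneCoeff, mul_zero]
      exact if_neg (by rintro ⟨⟩)
  rw [mul_apply, convolution_cons, coeff_nil, zero_mul, zero_add]
  simp only [coeff_cons]
  rw [convolution_smul_left, convolution_one_left, ite_mul, one_mul, zero_mul]

theorem ofPath_toPath_mul_ofPath {i j k : V} (p : Quiver.Path i j) (e : j ⟶ k) :
    ofPath e.toPath * ofPath p = ofPath (p.cons e) := by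
  classical
  funext s t q
  cases q with
  | nil =>
    rw [ofPath_toPath_mul_nil]
    exact (if_neg (by rintro ⟨⟩)).symm
  | cons q a =>
    rw [ofPath_toPath_mul_cons, ofPath, ofPath, ← ite_and]
    refine if_congr ⟨?_, fun h => by cases h; exact ⟨rfl, rfl⟩⟩ rfl rfl
    rintro ⟨ha, hq⟩
    cases ha
    cases hq
    rfl

theorem ofPath_toPath_mul_ofPath_eq_zero {i j k l : V} (p : Quiver.Path i j) (e : k ⟶ l)
    (h : j ≠ k) : ofPath e.toPath * ofPath p = 0 := by
  funext s t q
  cases q with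
  | nil => exact ofPath_toPath_mul_nil e _ s
  | cons q a =>
    rw [ofPath_toPath_mul_cons, ofPath, ← ite_and]
    refine if_neg ?_
    rintro ⟨ha, hq⟩
    cases ha
    cases hq
    exact h rfl

theorem sum_ofPath_nil [Fintype V] : ∑ i : V, ofPath (.nil : Quiver.Path i i) = 1 := by
  classical
  funext s t q
  rw [sum_apply]
  cases q with
  | nil =>
    have coeff (i : V) : ofPath (.nil : Quiver.Path i i) s s .nil = if s = i then 1 else 0 :=
      if_congr ⟨fun h => congrArg Sigma.fst h, fun h => by cases h; rfl⟩ rfl rfl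
    simp only [coeff, Finset.sum_ite_eq, Finset.mem_univ, if_true]
    rfl
  | cons q a => exact Finset.sum_eq_zero fun i _ => if_neg (by rintro ⟨⟩)

open Classical in
/-- The part of `f` supported on the paths that end with the arrow `e`, with `e` removed. -/
noncomputable def removeLast {k l : V} (e : k ⟶ l) (f : CompletedPathAlgebra V) :
    CompletedPathAlgebra V :=
  fun i j p => if h : k = j then f i l (p.cons (e.cast h rfl)) else 0

theorem removeLast_mem_arrowIdealPow {k l : V} (e : k ⟶ l) {m : ℕ} {f : CompletedPathAlgebra V}
    (hf : f ∈ arrowIdealPow V (m + 1)) : removeLast e f ∈ arrowIdealPow V m := by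
  rw [mem_arrowIdealPow] at hf ⊢
  intro i j p hp
  rw [removeLast]
  split_ifs with h
  · exact hf _ _ _ (Nat.succ_lt_succ hp)
  · rfl

theorem eq_sum_ofPath_mul_removeLast [Fintype (Σ s t : V, s ⟶ t)] {f : CompletedPathAlgebra V}
    (hf : f ∈ arrowIdealPow V 1) :
    f = ∑ e : Σ s t : V, s ⟶ t, ofPath e.2.2.toPath * removeLast e.2.2 f := by
  classical
  funext i j p
  rw [sum_apply]
  cases p with
  | nil =>
    simp only [ofPath_toPath_mul_nil, Finset.sum_const_zero]
    exact mem_arrowIdealPow.1 hf i i .nil Nat.one_pos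
  | cons p e =>
    simp only [ofPath_toPath_mul_cons, Sigma.eta, Finset.sum_ite_eq, Finset.mem_univ, if_true]
    simp only [removeLast, dif_pos, Quiver.Hom.cast_rfl_rfl]

theorem arrowIdealPow_antitone : Antitone (arrowIdealPow V) := fun _ _ hlm _ hf =>
  mem_arrowIdealPow.2 fun i j p hp => mem_arrowIdealPow.1 hf i j p (hp.trans_le hlm)

theorem finite_setOf_length_lt [Finite V] [∀ i j : V, Finite (i ⟶ j)] (m : ℕ) :
    {p : Σ i j : V, Quiver.Path i j | p.2.2.length < m}.Finite := by
  induction m with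
  | zero => simp
  | succ m ih =>
    have := ih.to_subtype
    let snoc (x : Σ p : {p : Σ i j : V, Quiver.Path i j | p.2.2.length < m},
        Σ k : V, p.1.2.1 ⟶ k) : Σ i j : V, Quiver.Path i j :=
      ⟨x.1.1.1, x.2.1, x.1.1.2.2.cons x.2.2⟩
    refine ((Set.finite_range fun i : V => ⟨i, i, .nil⟩).union (Set.finite_range snoc)).subset ?_
    rintro ⟨i, k, _ | ⟨p, e⟩⟩ hp
    · exact .inl ⟨i, rfl⟩
    · exact .inr ⟨⟨⟨⟨i, _, p⟩, Nat.lt_of_succ_lt_succ hp⟩, k, e⟩, rfl⟩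

theorem sub_sum_smul_ofPath_mem_arrowIdealPow {m : ℕ} (f : CompletedPathAlgebra V)
    [Fintype {p : Σ i j : V, Quiver.Path i j | p.2.2.length < m}] :
    f - ∑ p : {p : Σ i j : V, Quiver.Path i j | p.2.2.length < m},
      f p.1.1 p.1.2.1 p.1.2.2 • ofPath p.1.2.2 ∈ arrowIdealPow V m := by
  refine mem_arrowIdealPow.2 fun i j q hq => sub_eq_zero.2 ?_
  rw [sum_apply]
  refine ((Finset.sum_eq_single ⟨⟨i, j, q⟩, hq⟩ ?_ ?_).trans ?_).symm
  · exact fun p _ hp => (congrArg (_ * ·) (if_neg fun h => hp (Subtype.ext h.symm))).trans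
      (mul_zero _)
  · exact fun h => absurd (Finset.mem_univ _) h
  · exact (congrArg (f i j q * ·) (if_pos rfl)).trans (mul_one _)

section Ideal

variable {I : TwoSidedIdeal (CompletedPathAlgebra V)}

theorem finiteDimensional_quotient [Finite V] [∀ i j : V, Finite (i ⟶ j)] {m : ℕ}
    (hI : arrowIdealPow V m ≤ I) : FiniteDimensional ℂ I.ringCon.Quotient := by
  have := (finite_setOf_length_lt (V := V) m).fintype
  let π := I.ringCon.mkₐ ℂ
  refine Module.Finite.of_surjective (Fintype.linearCombination ℂ
    fun p : {p : Σ i j : V, Quiver.Path i j | p.2.2.length < m} => π (ofPath p.1.2.2)) fun x => ?_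
  obtain ⟨f, rfl⟩ : ∃ f, π f = x := RingCon.mkₐ_surjective (α := ℂ) I.ringCon x
  have truncation : π f = π (∑ p : {p : Σ i j : V, Quiver.Path i j | p.2.2.length < m},
      f p.1.1 p.1.2.1 p.1.2.2 • ofPath p.1.2.2) :=
    (RingCon.eq _).2 ((I.rel_iff _ _).2 (hI (sub_sum_smul_ofPath_mem_arrowIdealPow f)))
  refine ⟨fun p => f p.1.1 p.1.2.1 p.1.2.2, ?_⟩
  rw [truncation, map_sum, Fintype.linearCombination_apply]
  simp only [map_smul]

theorem mul_mem_of_forall_mul_ofPath_mem [Finite V] [∀ i j : V, Finite (i ⟶ j)] {m : ℕ}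
    {f g : CompletedPathAlgebra V} (hf : f ∈ arrowIdealPow V m)
    (hg : ∀ i j (p : Quiver.Path i j), p.length = m → g * ofPath p ∈ I) : g * f ∈ I := by
  induction m generalizing f g with
  | zero =>
    have := Fintype.ofFinite V
    rw [← one_mul f, ← sum_ofPath_nil, ← mul_assoc, Finset.mul_sum]
    exact I.mul_mem_right _ _ (sum_mem fun i _ => hg i i .nil rfl)
  | succ m ih =>
    have := Fintype.ofFinite (Σ s t : V, s ⟶ t)
    rw [eq_sum_ofPath_mul_removeLast (arrowIdealPow_antitone (Nat.succ_pos m) hf), Finset.mul_sum]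
    refine sum_mem fun e _ => ?_
    rw [← mul_assoc]
    refine ih (removeLast_mem_arrowIdealPow e.2.2 hf) fun i j p hp => ?_
    rw [mul_assoc]
    obtain ⟨s, t, a⟩ := e
    by_cases hjs : j = s
    · subst hjs
      rw [ofPath_toPath_mul_ofPath]
      exact hg i t (p.cons a) (congrArg (· + 1) hp)
    · rw [ofPath_toPath_mul_ofPath_eq_zero p a hjs, mul_zero]
      exact I.zero_mem

theorem ofPath_cons_mem_or_length_le (rank : ∀ ⦃i j : V⦄, (i ⟶ j) → ℕ)
    (hrank : ∀ ⦃i j k : V⦄ (a : i ⟶ j) (b : j ⟶ k),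
      ofPath (a.toPath.cons b) ∈ I ∨ rank a < rank b)
    {i j k : V} (p : Quiver.Path i j) (e : j ⟶ k) :
    ofPath (p.cons e) ∈ I ∨ p.length ≤ rank e := by
  induction p generalizing k with
  | nil => exact .inr (Nat.zero_le _)
  | cons p a ih =>
    rcases ih a with hpa | hpa
    · left
      rw [← ofPath_toPath_mul_ofPath]
      exact I.mul_mem_left _ _ hpa
    rcases hrank a e with hae | hae
    · left
      rw [← ofPath_toPath_mul_ofPath, ← ofPath_toPath_mul_ofPath, ← mul_assoc,
        ofPath_toPath_mul_ofPath]
      exact I.mul_mem_right _ _ hae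
    · exact .inr (hpa.trans_lt hae)

theorem arrowIdealPow_le_of_rank [Finite V] [∀ i j : V, Finite (i ⟶ j)]
    (rank : ∀ ⦃i j : V⦄, (i ⟶ j) → ℕ) {N : ℕ} (hN : ∀ ⦃i j : V⦄ (a : i ⟶ j), rank a < N)
    (hrank : ∀ ⦃i j k : V⦄ (a : i ⟶ j) (b : j ⟶ k),
      ofPath (a.toPath.cons b) ∈ I ∨ rank a < rank b) :
    arrowIdealPow V (N + 1) ≤ I := by
  intro f hf
  rw [← one_mul f]
  refine mul_mem_of_forall_mul_ofPath_mem hf fun i j p hp => ?_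
  rw [one_mul]
  cases p with
  | nil => exact absurd hp (Nat.succ_ne_zero N).symm
  | cons p e =>
    refine (ofPath_cons_mem_or_length_le rank hrank p e).resolve_right fun h => ?_
    exact (h.trans_lt (hN e)).ne (Nat.succ_injective hp)

end Ideal

end CompletedPathAlgebra

end PathAlgebra

/-! ### Potentials made of 3-cycles -/

section Jacobian

variable {V : Type*} [Quiver V]

theorem le_adicClosure (I : TwoSidedIdeal (CompletedPathAlgebra V)) : I ≤ adicClosure I :=
  le_iInf fun _ => le_sup_left

theorem cyclicDerivative_mem_jacobianIdeal (S : Potential V) {s t : V} (a : s ⟶ t) :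
    cyclicDerivative a S ∈ jacobianIdeal S :=
  le_adicClosure _ (TwoSidedIdeal.subset_span ⟨s, t, a, rfl⟩)

theorem length_add_length_of_mem_splits {i j : V} {p : Quiver.Path i j} :
    ∀ x ∈ splits p, x.2.1.length + x.2.2.length = p.length := by
  induction p with
  | nil => exact List.forall_mem_singleton.2 rfl
  | cons p e ih =>
    refine List.forall_mem_cons.2 ⟨rfl, List.forall_mem_map.2 fun x hx => ?_⟩
    exact congrArg (· + 1) (ih x hx)

theorem cyclicDerivative_apply_eq_zero_of_length_ne {S : Potential V} {m : ℕ}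
    (hS : ∀ i (c : Quiver.Path i i), c.length ≠ m + 1 → S i c = 0) {s t : V} (a : s ⟶ t)
    {i j : V} {p : Quiver.Path i j} (hp : p.length ≠ m) : cyclicDerivative a S i j p = 0 := by
  rw [cyclicDerivative]
  split_ifs with h
  · obtain ⟨rfl, rfl⟩ := h
    refine List.sum_eq_zero (List.forall_mem_map.2 fun x hx => hS _ _ ?_)
    have := length_add_length_of_mem_splits x hx
    rw [Quiver.Path.cast_rfl_rfl] at this
    rw [Quiver.Path.length_comp, Quiver.Path.length_cons]
    omega
  · rfl

theorem cyclicDerivative_apply_toPath_cons (S : Potential V) {s t k : V} (a : s ⟶ t)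
    (b : t ⟶ k) (c : k ⟶ s) :
    cyclicDerivative a S t s (b.toPath.cons c) =
      S s ((a.toPath.cons b).cons c) + S k ((c.toPath.cons a).cons b) +
        S t ((b.toPath.cons c).cons a) := by
  simp [cyclicDerivative, splits, add_assoc, Quiver.Path.comp, Quiver.Hom.toPath]

/-- The condition that `C` contains the cycle with successive arrows `a`, `b`, `c`, up to
rotation. -/
def HasRotationIn (C : Set (Σ i : V, Quiver.Path i i)) {s t k : V} (a : s ⟶ t) (b : t ⟶ k)
    (c : k ⟶ s) : Prop :=
  ⟨s, (a.toPath.cons b).cons c⟩ ∈ C ∨ ⟨k, (c.toPath.cons a).cons b⟩ ∈ C ∨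
    ⟨t, (b.toPath.cons c).cons a⟩ ∈ C

variable {C : Set (Σ i : V, Quiver.Path i i)}

theorem sumOfCycles_apply_of_notMem {i : V} {c : Quiver.Path i i}
    (h : (⟨i, c⟩ : Σ i : V, Quiver.Path i i) ∉ C) : sumOfCycles C i c = 0 := by
  rw [sumOfCycles]
  exact Set.indicator_of_notMem h 1

theorem cyclicDerivative_sumOfCycles_apply_ne_zero_iff {s t k : V} {a : s ⟶ t} {b : t ⟶ k}
    {c : k ⟶ s} :
    cyclicDerivative a (sumOfCycles C) t s (b.toPath.cons c) ≠ 0 ↔ HasRotationIn C a b c := by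
  classical
  simp only [cyclicDerivative_apply_toPath_cons, sumOfCycles, Set.indicator_apply,
    Set.mem_ofPred_eq, Pi.one_apply, HasRotationIn]
  split_ifs <;> norm_num [*]

theorem exists_hasRotationIn_of_cyclicDerivative_ne_zero (hC : ∀ c ∈ C, c.2.length = 3)
    {s t i j : V} {a : s ⟶ t} {p : Quiver.Path i j}
    (hp : cyclicDerivative a (sumOfCycles C) i j p ≠ 0) :
    ∃ (k : V) (b : t ⟶ k) (c : k ⟶ s), HasRotationIn C a b c ∧
      (⟨i, j, p⟩ : Σ i j : V, Quiver.Path i j) = ⟨t, s, b.toPath.cons c⟩ := by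
  have ends : i = t ∧ j = s := by
    by_contra h
    exact hp (dif_neg h)
  have length_eq : p.length = 2 := by
    by_contra h
    refine hp (cyclicDerivative_apply_eq_zero_of_length_ne (fun i c hc => ?_) a h)
    exact sumOfCycles_apply_of_notMem fun hcC => hc (hC ⟨i, c⟩ hcC)
  obtain ⟨rfl, rfl⟩ := ends
  match p, length_eq with
  | .cons (.cons .nil b) c, _ =>
    exact ⟨_, b, c, cyclicDerivative_sumOfCycles_apply_ne_zero_iff.1 hp, rfl⟩

theorem ofPath_mem_jacobianIdeal (hC : ∀ c ∈ C, c.2.length = 3) {s t k : V} {a : s ⟶ t}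
    {b : t ⟶ k} {c : k ⟶ s} (h : HasRotationIn C a b c)
    (unique : ∀ (k' : V) (b' : t ⟶ k') (c' : k' ⟶ s), HasRotationIn C a b' c' →
      (⟨k', b', c'⟩ : Σ k' : V, (t ⟶ k') × (k' ⟶ s)) = ⟨k, b, c⟩) :
    CompletedPathAlgebra.ofPath (b.toPath.cons c) ∈ jacobianIdeal (sumOfCycles C) := by
  set coeff := cyclicDerivative a (sumOfCycles C) t s (b.toPath.cons c)
  have coeff_ne_zero : coeff ≠ 0 := cyclicDerivative_sumOfCycles_apply_ne_zero_iff.2 h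
  have derivative_eq : cyclicDerivative a (sumOfCycles C) =
      coeff • CompletedPathAlgebra.ofPath (b.toPath.cons c) := by
    refine CompletedPathAlgebra.eq_smul_ofPath _ _ fun i j p hp => ?_
    obtain ⟨k', b', c', h', hp⟩ := exists_hasRotationIn_of_cyclicDerivative_ne_zero hC hp
    cases unique k' b' c' h'
    exact hp
  have mem := (jacobianIdeal (sumOfCycles C)).mul_mem_left (algebraMap ℂ _ coeff⁻¹) _
    (cyclicDerivative_mem_jacobianIdeal _ a)
  rwa [← Algebra.smul_def, derivative_eq, inv_smul_smul₀ coeff_ne_zero] at mem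

end Jacobian

/-! ### Crossing arcs -/

section Crossing

/-- The open half circle in the upper half plane with end points `a` and `b`. The equation is that
of the circle with diameter `[a, b]`. -/
def semicircle (a b : ℝ) : Set ℂ := {z | 0 < z.im ∧ z.im ^ 2 = (z.re - a) * (b - z.re)}

theorem norm_sub_midpoint_of_mem_semicircle {a b : ℝ} (hab : a ≤ b) {z : ℂ}
    (hz : z ∈ semicircle a b) : ‖z - ((a + b) / 2 : ℝ)‖ = (b - a) / 2 := by
  have radius_nonneg : 0 ≤ (b - a) / 2 := by linarith
  rw [← sq_eq_sq₀ (norm_nonneg _) radius_nonneg, ← Complex.normSq_eq_norm_sq, Complex.normSq_apply,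
    Complex.sub_re, Complex.sub_im, Complex.ofReal_re, Complex.ofReal_im]
  linear_combination hz.2

theorem semicircle_inter_semicircle_nonempty {a b c d : ℝ} (hac : a < c) (hcb : c < b)
    (hbd : b < d) : (semicircle a b ∩ semicircle c d).Nonempty := by
  have hD : 0 < c + d - a - b := by linarith
  -- Subtracting the equations of the two circles gives the abscissa of their radical axis.
  set u := (c * d - a * b) / (c + d - a - b) with hu
  have radical_axis : (u - a) * (b - u) = (u - c) * (d - u) := by
    linear_combination -div_mul_cancel₀ (c * d - a * b) hD.ne'
  have sub_left : u - a = (c - a) * (d - a) / (c + d - a - b) := by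
    rw [hu]
    field_simp
    ring
  have sub_right : b - u = (b - c) * (d - b) / (c + d - a - b) := by
    rw [hu]
    field_simp
    ring
  have height_pos : 0 < (u - a) * (b - u) := by
    rw [sub_left, sub_right]
    have := sub_pos.2 hac
    have := sub_pos.2 hcb
    have := sub_pos.2 hbd
    have := sub_pos.2 (hac.trans (hcb.trans hbd))
    positivity
  have sq_sqrt := Real.sq_sqrt height_pos.le
  exact ⟨⟨u, √((u - a) * (b - u))⟩, ⟨Real.sqrt_pos.2 height_pos, sq_sqrt⟩,
    Real.sqrt_pos.2 height_pos, sq_sqrt.trans radical_axis⟩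

/-- The universal covering of the disk without the orbifold point by the upper half plane, under
which the marked point `v_a` lifts to the integers congruent to `a` modulo `n + 1`. -/
noncomputable def cover (n : ℕ) (z : ℂ) : ℂ := Complex.exp (2 * Real.pi * Complex.I * z / (n + 1))

variable {n : ℕ}

theorem cover_add_intCast_mul (z : ℂ) (m : ℤ) : cover n (z + m * (n + 1)) = cover n z := by
  have : (n : ℂ) + 1 ≠ 0 := Nat.cast_add_one_ne_zero n
  refine Complex.exp_eq_exp_iff_exists_int.2 ⟨m, ?_⟩
  field_simp

namespace Segment

theorem cover_mem_curve (s : Segment n) {a : ℤ} (ha : (a : ZMod (n + 1)) = s.start) {z : ℂ}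
    (hz : z ∈ semicircle a (a + s.len)) : cover n z ∈ s.curve := by
  obtain ⟨m, hm⟩ : (n + 1 : ℤ) ∣ s.start.val - a := by
    have : ((s.start.val - a : ℤ) : ZMod (n + 1)) = 0 := by
      push_cast
      rw [ZMod.natCast_zmod_val, ha, sub_self]
    exact_mod_cast (ZMod.intCast_zmod_eq_zero_iff_dvd _ _).1 this
  have start_eq : (s.start.val : ℂ) = a + m * (n + 1) := by
    have : (s.start.val : ℤ) = a + m * (n + 1) := by linear_combination hm
    exact_mod_cast this
  have norm_eq := norm_sub_midpoint_of_mem_semicircle (by simp) hz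
  rw [← cover_add_intCast_mul z m]
  refine ⟨_, ⟨?_, ?_⟩, rfl⟩
  · simpa using hz.1
  · rw [start_eq]
    convert norm_eq using 2
    · push_cast
      ring
    · ring

theorem not_compatible_of_crossing {s t : Segment n} {x : ℕ} (hst : t.start = s.start + x)
    (hx : 0 < x) (hxs : x < s.len) (hs : s.len < x + t.len) : ¬ s.Compatible t := by
  rintro (rfl | disjoint)
  · have dvd : n + 1 ∣ x := (ZMod.natCast_eq_zero_iff _ _).1 (by simpa using hst.symm)
    exact absurd (Nat.le_of_dvd hx dvd) (hxs.trans_le s.len_le).not_ge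
  · have lift_s : ((s.start.val : ℤ) : ZMod (n + 1)) = s.start := by simp
    have lift_t : ((s.start.val + x : ℤ) : ZMod (n + 1)) = t.start := by simp [hst]
    obtain ⟨z, hzs, hzt⟩ : (semicircle (s.start.val : ℤ) ((s.start.val : ℤ) + s.len) ∩
        semicircle (s.start.val + x : ℤ) ((s.start.val + x : ℤ) + t.len)).Nonempty := by
      apply semicircle_inter_semicircle_nonempty <;> norm_cast <;> omega
    exact Set.disjoint_left.1 disjoint (s.cover_mem_curve lift_s hzs) (t.cover_mem_curve lift_t hzt)

instance : Finite (Segment n) := by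
  refine Finite.of_injective (β := ZMod (n + 1) × Fin (n + 2))
    (fun s => (s.start, ⟨s.len, Nat.lt_succ_of_le s.len_le⟩)) fun s t h => ?_
  rw [Prod.mk.injEq, Fin.mk.injEq] at h
  exact Segment.ext h.1 h.2

end Segment

end Crossing

/-! ### Nonzero paths of `Q(τ)` -/

namespace Triangulation

variable {n : ℕ} {τ : Triangulation n}

theorem add_len_le_of_start_eq {s t : Segment n} (hs : s.IsBoundary ∨ s ∈ τ.arcs)
    (ht : t.IsBoundary ∨ t ∈ τ.arcs) {x : ℕ} (hst : t.start = s.start + x) (hx : 0 < x)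
    (hxs : x < s.len) : x + t.len ≤ s.len := by
  by_contra! crossing
  rcases hs with hs | hs
  · rw [Segment.IsBoundary] at hs
    omega
  rcases ht with ht | ht
  · rw [Segment.IsBoundary] at ht
    omega
  exact Segment.not_compatible_of_crossing hst hx hxs crossing (τ.compatible _ hs _ ht)

namespace Triangle

variable {Δ Δ' : τ.Triangle}

theorem toTriple_injective : Function.Injective (toTriple : τ.Triangle → Triple n) := by
  rintro ⟨Δ, _⟩ ⟨Δ', _⟩ rfl
  rfl

theorem d_le_of_side_zero_eq (h : Δ.side 0 = Δ'.side 0) : Δ'.d ≤ Δ.d := by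
  have start_eq : Δ.start = Δ'.start := congrArg Segment.start h
  have len_eq : Δ.d + Δ.e = Δ'.d + Δ'.e := congrArg Segment.len h
  by_contra! hlt
  have : Δ.d + Δ.e ≤ Δ'.d := add_len_le_of_start_eq (Δ'.side_mem 2) (Δ.side_mem 1)
    (congrArg (· + (Δ.d : ZMod (n + 1))) start_eq) Δ.one_le_d hlt
  have := Δ'.one_le_e
  omega

theorem d_le_of_side_one_eq (h : Δ.side 1 = Δ'.side 1) : Δ'.d ≤ Δ.d := by
  have start_eq : Δ.start + Δ.d = Δ'.start + Δ'.d := congrArg Segment.start h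
  have one_le_d := Δ.one_le_d
  have one_le_e := Δ.one_le_e
  by_contra! hlt
  have start_eq_add : Δ.start = Δ'.start + (Δ'.d - Δ.d : ℕ) := by
    rw [Nat.cast_sub hlt.le]
    linear_combination start_eq
  have : Δ'.d - Δ.d + (Δ.d + Δ.e) ≤ Δ'.d := add_len_le_of_start_eq (Δ'.side_mem 2) (Δ.side_mem 0)
    start_eq_add (Nat.sub_pos_of_lt hlt) (Nat.sub_lt (by omega) one_le_d)
  omega

theorem e_le_of_side_two_eq (h : Δ.side 2 = Δ'.side 2) : Δ'.e ≤ Δ.e := by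
  have start_eq : Δ'.start = Δ.start := (congrArg Segment.start h).symm
  have d_eq : Δ'.d = Δ.d := (congrArg Segment.len h).symm
  have side_one_start_eq : (Δ'.side 1).start = (Δ.side 0).start + Δ.d :=
    congrArg₂ (fun a (d : ℕ) => a + (d : ZMod (n + 1))) start_eq d_eq
  have : Δ.d + Δ'.e ≤ Δ.d + Δ.e := add_len_le_of_start_eq (Δ.side_mem 0) (Δ'.side_mem 1)
    side_one_start_eq Δ.one_le_d (Nat.lt_add_of_pos_right Δ.one_le_e)
  omega

theorem side_injective (k : Fin 3) : Function.Injective fun Δ : τ.Triangle => Δ.side k := by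
  intro Δ Δ' (h : Δ.side k = Δ'.side k)
  refine toTriple_injective ?_
  match k with
  | 0 =>
    have d_eq := le_antisymm (d_le_of_side_zero_eq h.symm) (d_le_of_side_zero_eq h)
    have len_eq : Δ.d + Δ.e = Δ'.d + Δ'.e := congrArg Segment.len h
    exact Triple.ext (congrArg Segment.start h) d_eq (by omega)
  | 1 =>
    have d_eq := le_antisymm (d_le_of_side_one_eq h.symm) (d_le_of_side_one_eq h)
    have start_eq : Δ.start + Δ.d = Δ'.start + Δ'.d := congrArg Segment.start h
    rw [d_eq] at start_eq
    exact Triple.ext (add_right_cancel start_eq) d_eq (congrArg Segment.len h)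
  | 2 =>
    have e_eq := le_antisymm (e_le_of_side_two_eq h.symm) (e_le_of_side_two_eq h)
    exact Triple.ext (congrArg Segment.start h) (congrArg Segment.len h) e_eq

theorem side_one_ne_side_two (Δ Δ' : τ.Triangle) : Δ.side 1 ≠ Δ'.side 2 := by
  intro h
  have d_eq : Δ'.d = Δ.e := (congrArg Segment.len h).symm
  have : Δ.d + (Δ'.d + Δ'.e) ≤ Δ.d + Δ.e :=
    add_len_le_of_start_eq (Δ.side_mem 0) (Δ'.side_mem 0) (congrArg Segment.start h).symm
      Δ.one_le_d (Nat.lt_add_of_pos_right Δ.one_le_e)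
  have := Δ'.one_le_e
  omega

theorem eq_zero_of_isPending_side {k : Fin 3} (h : (Δ.side k).IsPending) : k = 0 := by
  have := Δ.one_le_d
  have := Δ.one_le_e
  have := Δ.add_le
  match k with
  | 0 => rfl
  | 1 =>
    have : Δ.e = n + 1 := h
    omega
  | 2 =>
    have : Δ.d = n + 1 := h
    omega

end Triangle

variable (τ) in
/-- A name for an arrow of `Q(τ)` which does not mention its end points: `inl (Δ, k)` for the arrow
from the `k`-th to the `(k + 1)`-st side of `Δ`, and `inr i` for the loop at the pending arc `i`. -/
abbrev ArrowLabel : Type := (τ.Triangle × Fin 3) ⊕ τ.Vertex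

/-- The label of an arrow of `Q(τ)`: arrows with different end points are compared through it. -/
def label : ∀ {i j : τ.Vertex}, (i ⟶ j) → τ.ArrowLabel
  | _, _, .ofTriangle Δ k _ _ => .inl (Δ, k)
  | _, _, .loop i _ => .inr i

theorem label_eq_label_iff {i j i' j' : τ.Vertex} {a : i ⟶ j} {a' : i' ⟶ j'} :
    label a = label a' ↔ (⟨i, j, a⟩ : Σ i j : τ.Vertex, i ⟶ j) = ⟨i', j', a'⟩ := by
  refine ⟨fun h => ?_, fun h => by cases h; rfl⟩
  rcases a with ⟨Δ, k, _, _⟩ | ⟨i, _⟩ <;> rcases a' with ⟨Δ', k', _, _⟩ | ⟨i', _⟩ <;> cases h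
  all_goals rfl

theorem exists_label_eq_inl_iff {i j : τ.Vertex} {Δ : τ.Triangle} {k : Fin 3} :
    (∃ a : i ⟶ j, label a = .inl (Δ, k)) ↔ i.arc = Δ.side k ∧ j.arc = Δ.side (k + 1) := by
  constructor
  · rintro ⟨⟨Δ', k', _, _⟩ | _, h⟩ <;> cases h
    exact ⟨rfl, rfl⟩
  · obtain ⟨i, hi⟩ := i
    obtain ⟨j, hj⟩ := j
    rintro ⟨rfl, rfl⟩
    exact ⟨.ofTriangle Δ k hi hj, rfl⟩

theorem exists_label_eq_inr_iff {i j v : τ.Vertex} :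
    (∃ a : i ⟶ j, label a = .inr v) ↔ i = v ∧ j = v ∧ v.arc.IsPending := by
  constructor
  · rintro ⟨_ | ⟨_, hv⟩, h⟩ <;> cases h
    exact ⟨rfl, rfl, hv⟩
  · rintro ⟨rfl, rfl, hv⟩
    exact ⟨.loop j hv, rfl⟩

/-- The label of the arrow that follows in the 3-cycle of a triangle, or in `ε³`. -/
def nextLabel : τ.ArrowLabel → τ.ArrowLabel
  | .inl (Δ, k) => .inl (Δ, k + 1)
  | .inr i => .inr i

theorem nextLabel_nextLabel_nextLabel (x : τ.ArrowLabel) :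
    nextLabel (nextLabel (nextLabel x)) = x := by
  rcases x with ⟨Δ, k⟩ | i
  · exact congrArg (fun l => Sum.inl (Δ, l)) (by omega : k + 1 + 1 + 1 = k)
  · rfl

theorem exists_label_eq_nextLabel {i j k : τ.Vertex} {a : i ⟶ j} {b : j ⟶ k}
    (h : label b = nextLabel (label a)) : ∃ c : k ⟶ i, label c = nextLabel (label b) := by
  rcases ha : label a with ⟨Δ, l⟩ | v <;> rw [h, ha]
  · have hi := (exists_label_eq_inl_iff.1 ⟨a, ha⟩).1
    have hk := (exists_label_eq_inl_iff.1 ⟨b, h.trans (congrArg _ ha)⟩).2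
    exact exists_label_eq_inl_iff.2 ⟨hk, hi.trans (congrArg _ (by omega : l = l + 1 + 1 + 1))⟩
  · obtain ⟨hi, -, hv⟩ := exists_label_eq_inr_iff.1 ⟨a, ha⟩
    have hk := (exists_label_eq_inr_iff.1 ⟨b, h.trans (congrArg _ ha)⟩).2.1
    exact exists_label_eq_inr_iff.2 ⟨hk, hi, hv⟩

variable (τ) in
/-- The cycles whose sum is the potential `S(τ)`. -/
def cycles : Set (Σ i : τ.Vertex, Quiver.Path i i) :=
  {c | ∃ (Δ : τ.Triangle) (h : Δ.IsInternal), c = τ.triangleCycle Δ h} ∪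
    {c | ∃ (i : τ.Vertex) (h : i.arc.IsPending), c = τ.loopCycle i h}

theorem potential_eq_sumOfCycles : τ.potential = sumOfCycles τ.cycles := rfl

theorem length_eq_three_of_mem_cycles : ∀ c ∈ τ.cycles, c.2.length = 3 := by
  rintro _ (⟨Δ, h, rfl⟩ | ⟨i, h, rfl⟩) <;> rfl

theorem cycle_eq_cycle_iff {i j k i' j' k' : τ.Vertex} {a : i ⟶ j} {b : j ⟶ k} {c : k ⟶ i}
    {a' : i' ⟶ j'} {b' : j' ⟶ k'} {c' : k' ⟶ i'} :
    (⟨i, (a.toPath.cons b).cons c⟩ : Σ i : τ.Vertex, Quiver.Path i i) =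
        ⟨i', (a'.toPath.cons b').cons c'⟩ ↔
      label a = label a' ∧ label b = label b' ∧ label c = label c' := by
  constructor
  · intro h
    cases h
    exact ⟨rfl, rfl, rfl⟩
  · simp only [label_eq_label_iff]
    rintro ⟨ha, hb, hc⟩
    cases ha
    cases hb
    cases hc
    rfl

theorem mem_cycles_iff {i j k : τ.Vertex} {a : i ⟶ j} {b : j ⟶ k} {c : k ⟶ i} :
    (⟨i, (a.toPath.cons b).cons c⟩ : Σ i : τ.Vertex, Quiver.Path i i) ∈ τ.cycles ↔
      (∃ Δ, label a = .inl (Δ, 0) ∧ label b = .inl (Δ, 1) ∧ label c = .inl (Δ, 2)) ∨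
        ∃ v, label a = .inr v ∧ label b = .inr v ∧ label c = .inr v := by
  refine or_congr (exists_congr fun Δ => ?_) (exists_congr fun v => ?_)
  · refine ⟨fun ⟨_, h⟩ => cycle_eq_cycle_iff.1 h, fun h => ?_⟩
    have internal : Δ.IsInternal
      | 0 => (exists_label_eq_inl_iff.1 ⟨a, h.1⟩).1 ▸ i.mem
      | 1 => (exists_label_eq_inl_iff.1 ⟨b, h.2.1⟩).1 ▸ j.mem
      | 2 => (exists_label_eq_inl_iff.1 ⟨c, h.2.2⟩).1 ▸ k.mem
    exact ⟨internal, cycle_eq_cycle_iff.2 h⟩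
  · refine ⟨fun ⟨_, h⟩ => cycle_eq_cycle_iff.1 h, fun h => ?_⟩
    exact ⟨(exists_label_eq_inr_iff.1 ⟨a, h.1⟩).2.2, cycle_eq_cycle_iff.2 h⟩

theorem hasRotationIn_cycles_iff {i j k : τ.Vertex} {a : i ⟶ j} {b : j ⟶ k} {c : k ⟶ i} :
    HasRotationIn τ.cycles a b c ↔
      label b = nextLabel (label a) ∧ label c = nextLabel (label b) := by
  simp only [HasRotationIn, mem_cycles_iff]
  constructor
  · rintro ((⟨Δ, h⟩ | ⟨v, h⟩) | (⟨Δ, h⟩ | ⟨v, h⟩) | (⟨Δ, h⟩ | ⟨v, h⟩)) <;>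
      simp [h, nextLabel]
  · rintro ⟨hb, hc⟩
    rcases ha : label a with ⟨Δ, l⟩ | v <;> rw [ha] at hb <;> rw [hb] at hc
    · fin_cases l
      · exact .inl (.inl ⟨Δ, rfl, hb, hc⟩)
      · exact .inr (.inl (.inl ⟨Δ, hc, rfl, hb⟩))
      · exact .inr (.inr (.inl ⟨Δ, hb, hc, rfl⟩))
    · exact .inl (.inr ⟨v, rfl, hb, hc⟩)

theorem ofPath_mem_jacobianIdeal_potential {i j k : τ.Vertex} {a : i ⟶ j} {b : j ⟶ k}
    (h : label b = nextLabel (label a)) :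
    CompletedPathAlgebra.ofPath (a.toPath.cons b) ∈ jacobianIdeal τ.potential := by
  rw [potential_eq_sumOfCycles]
  obtain ⟨c, hc⟩ := exists_label_eq_nextLabel h
  have ha : label a = nextLabel (label c) := by rw [hc, h, nextLabel_nextLabel_nextLabel]
  refine ofPath_mem_jacobianIdeal length_eq_three_of_mem_cycles (a := c)
    (hasRotationIn_cycles_iff.2 ⟨ha, h⟩) fun j' a' b' hab => ?_
  obtain ⟨ha', hb'⟩ := hasRotationIn_cycles_iff.1 hab
  cases label_eq_label_iff.1 (ha'.trans ha.symm)
  cases label_eq_label_iff.1 (hb'.trans h.symm)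
  rfl

/-- A measure of progress along nonzero paths. The arrows at positions `2` and `0` of a triangle
lead to a longer and to a shorter arc; they are ranked by the length of their target and, above all
other arrows, by minus the length of their target. The loop and the arrows at position `1`, which
cross from one side of the longest arc of a triangle to the other, lie in between. -/
def labelRank : τ.ArrowLabel → ℕ
  | .inl (Δ, 0) => 2 * n + 4 - Δ.e
  | .inl (_, 1) => n + 2
  | .inl (Δ, 2) => Δ.d + Δ.e
  | .inr _ => n + 2

theorem labelRank_lt (x : τ.ArrowLabel) : labelRank x < 2 * n + 4 := by
  rcases x with ⟨Δ, k⟩ | v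
  · have := Δ.one_le_e
    have := Δ.add_le
    fin_cases k <;> simp only [labelRank] <;> omega
  · simp only [labelRank]
    omega

theorem eq_or_labelRank_lt_of_side_eq {Δ Δ' : τ.Triangle} {k k' : Fin 3}
    (h : Δ.side (k + 1) = Δ'.side k') :
    (Δ' = Δ ∧ k' = k + 1) ∨
      labelRank (.inl (Δ, k) : τ.ArrowLabel) < labelRank (.inl (Δ', k') : τ.ArrowLabel) := by
  have := Δ.one_le_e
  have := Δ.add_le
  have := Δ'.one_le_d
  have := Δ'.one_le_e
  have := Δ'.add_le
  match k, k' with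
  | 0, 1 | 1, 2 | 2, 0 => exact .inl ⟨(Triangle.side_injective _ h).symm, rfl⟩
  | 0, 2 => exact absurd h (Triangle.side_one_ne_side_two _ _)
  | 1, 1 => exact absurd h.symm (Triangle.side_one_ne_side_two _ _)
  | 0, 0 =>
    have : Δ.e = Δ'.d + Δ'.e := congrArg Segment.len h
    simp only [labelRank]
    omega
  | 2, 2 =>
    have : Δ.d + Δ.e = Δ'.d := congrArg Segment.len h
    simp only [labelRank]
    omega
  | 1, 0 | 2, 1 =>
    simp only [labelRank]
    omega

theorem label_eq_nextLabel_or_labelRank_lt {i j k : τ.Vertex} (a : i ⟶ j) (b : j ⟶ k) :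
    label b = nextLabel (label a) ∨ labelRank (label a) < labelRank (label b) := by
  rcases ha : label a with ⟨Δ, l⟩ | v <;> rcases hb : label b with ⟨Δ', l'⟩ | v'
  · have target_a := (exists_label_eq_inl_iff.1 ⟨a, ha⟩).2
    have source_b := (exists_label_eq_inl_iff.1 ⟨b, hb⟩).1
    refine (eq_or_labelRank_lt_of_side_eq (target_a.symm.trans source_b)).imp_left ?_
    rintro ⟨rfl, rfl⟩
    rfl
  · right
    have target_a := (exists_label_eq_inl_iff.1 ⟨a, ha⟩).2
    obtain ⟨rfl, -, pending⟩ := exists_label_eq_inr_iff.1 ⟨b, hb⟩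
    obtain rfl : l = 2 := by
      have : l + 1 = 0 := Triangle.eq_zero_of_isPending_side (target_a ▸ pending)
      omega
    have := Δ.add_le
    simp only [labelRank]
    omega
  · right
    obtain ⟨-, rfl, pending⟩ := exists_label_eq_inr_iff.1 ⟨a, ha⟩
    have source_b := (exists_label_eq_inl_iff.1 ⟨b, hb⟩).1
    obtain rfl : l' = 0 := Triangle.eq_zero_of_isPending_side (source_b ▸ pending)
    have := Δ'.one_le_d
    have := Δ'.add_le
    simp only [labelRank]
    omega
  · left
    obtain ⟨-, rfl, -⟩ := exists_label_eq_inr_iff.1 ⟨a, ha⟩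
    obtain ⟨rfl, -, -⟩ := exists_label_eq_inr_iff.1 ⟨b, hb⟩
    rfl

instance : Finite τ.Triangle := Finite.of_injective _ (Triangle.side_injective 0)

instance : Finite τ.Vertex := Finite.of_injective Vertex.arc fun _ _ => Vertex.ext

instance (i j : τ.Vertex) : Finite (i ⟶ j) :=
  Finite.of_injective (label : (i ⟶ j) → τ.ArrowLabel) fun a b h => by
    cases label_eq_label_iff.1 h
    rfl

theorem arrowIdealPow_le_jacobianIdeal :
    arrowIdealPow τ.Vertex (2 * n + 5) ≤ jacobianIdeal τ.potential :=
  CompletedPathAlgebra.arrowIdealPow_le_of_rank (fun _ _ a => labelRank (label a))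
    (fun _ _ _ => labelRank_lt _) fun _ _ _ a b =>
      (label_eq_nextLabel_or_labelRank_lt a b).imp_left ofPath_mem_jacobianIdeal_potential

end Triangulation

end OrbifoldPolygon

theorem mainTheorem12 (n : ℕ) (hn : 2 ≤ n) (τ : OrbifoldPolygon.Triangulation n) :
    FiniteDimensional ℂ τ.Lam := by
  open OrbifoldPolygon in
  exact CompletedPathAlgebra.finiteDimensional_quotient
    Triangulation.arrowIdealPow_le_jacobianIdeal
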